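/- Let $\Lambda=(\Lambda^0,\Lambda^1,r,s)$ be a row-finite directed graph with vertex set $\Lambda^0$, edge set $\Lambda^1$ and range and source maps $r,s:\Lambda^1\to\Lambda^0$; for a vertex $v$ let $v\Lambda^1:=\{\lambda\in\Lambda^1: r(\lambda)=v\}$, which is a finite set. Let $d:\Lambda^0\to\mathbb N$, $v\mapsto d_v$, be a finitely supported function, put $D(v):=\sum_{\lambda\in v\Lambda^1}d_{s(\lambda)}$, and assume that $d_v\le D(v)$ for all $v\in\Lambda^0$. Let $$M(d):=\bigoplus_{\lambda\in\Lambda^1}M_{d_{s(\lambda)},d_{r(\lambda)}}(\mathbb C),$$ a finite-dimensional real vector space with its usual topology and smooth structure. For $A=(A_\lambda)_\lambda\in M(d)$ and $v\in\Lambda^0$ let $R_v$ be the $D(v)\times d_v$ block column matrix with blocks $A_\lambda$, $\lambda\in v\Lambda^1$. Let $\mathrm{MR}(d)\subset M(d)$ be the set of $d$-dimensional matrix modules, i.e. of those $A$ for which every $R_v$ is an isometry: $R_v^*R_v=I_{d_v}$ for all $v\in\Lambda^0$. Let $H(d):=\bigoplus_{v\in\Lambda^0}\{C\in M_{d_v}(\mathbb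 C): C=C^*\}$ and define $$f:M(d)\to H(d),\qquad f\big((A_\lambda)_\lambda\big)=\Big(\sum_{\lambda\in v\Lambda^1}A_\lambda^*A_\lambda\Big)_{v\in\Lambda^0}.$$ Then $\mathrm{MR}(d)=f^{-1}\big((I_{d_v})_{v}\big)$, and $\mathrm{MR}(d)$ is a nonempty compact smooth (embedded) submanifold of $M(d)$, of real dimension $$\dim \mathrm{MR}(d)=\sum_{v\in\Lambda^0}d_v\,(2D(v)-d_v)=2\sum_{\lambda\in\Lambda^1}d_{s(\lambda)}d_{r(\lambda)}-\sum_{v\in\Lambda^0}d_v^2 .$$ Moreover $\dim \mathrm{MR}(d)\ge\sum_{v\in\Lambda^0}d_v^2$. -/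

import Mathlib

/-!
A directed graph `(Λ⁰, Λ¹, r, s)` is a quiver on the vertex set `V = Λ⁰`, an arrow `w ⟶ v` being an
edge with source `w` and range `v`. Then `Λ¹` is `Quiver.Total V` (with `s = left`, `r = right`) and
`vΛ¹`, the set of edges with range `v`, is `Quiver.Costar v`. The graph is row-finite when every
`Quiver.Costar v` is finite. A finite dimension vector is a `d : V →₀ ℕ`.
-/

namespace MatrixModule

universe u w

/-- An element of `vΛ¹` seen as an edge, i.e. as an element of `Λ¹`. -/
abbrev edge {V : Type u} [Quiver.{w} V] {v : V} (e : Quiver.Costar v) : Quiver.Total V :=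
  ⟨e.1, v, e.2⟩

/-- `M(d)`, the direct sum over all edges `λ` of the spaces of complex `d_{s(λ)} × d_{r(λ)}`
matrices. For a row-finite graph and a finitely supported `d` all but finitely many summands are
zero, so that the direct sum is the product; it carries the product topology, which is the usual
topology of this finite-dimensional vector space. -/
abbrev M {V : Type u} [Quiver.{w} V] (d : V →₀ ℕ) : Type (max u w) :=
  ∀ e : Quiver.Total V, Matrix (Fin (d e.left)) (Fin (d e.right)) ℂ

/-- `H(d)`, the direct sum (equivalently the product) over all vertices `v` of the real vector
spaces of Hermitian `d_v × d_v` matrices. -/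
abbrev H {V : Type u} (d : V →₀ ℕ) : Type u :=
  ∀ v : V, selfAdjoint (Matrix (Fin (d v)) (Fin (d v)) ℂ)

/-- The block column matrix `R_v` of size `D(v) × d_v` with the blocks `A_λ`, `λ ∈ vΛ¹`. -/
def R {V : Type u} [Quiver.{w} V] {d : V →₀ ℕ} (A : M d) (v : V) :
    Matrix (Σ e : Quiver.Costar v, Fin (d e.1)) (Fin (d v)) ℂ :=
  Matrix.of fun p j => A (edge p.1) p.2 j

section

variable {V : Type u} [Quiver.{w} V] [∀ v : V, Fintype (Quiver.Costar v)]

/-- `D(v) = ∑_{λ ∈ vΛ¹} d_{s(λ)}`. -/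
def D (d : V →₀ ℕ) (v : V) : ℕ := ∑ e : Quiver.Costar v, d e.1

/-- `MR(d)`, the set of `d`-dimensional matrix modules: the tuples `A` for which every `R_v` is an
isometry. -/
def MR (d : V →₀ ℕ) : Set (M d) :=
  {A | ∀ v : V, (R A v).conjTranspose * R A v = 1}

/-- The map `f : M(d) → H(d)`, `(A_λ)_λ ↦ (∑_{λ ∈ vΛ¹} A_λ^* A_λ)_v`. -/
def f {d : V →₀ ℕ} (A : M d) : H d := fun v =>
  ∑ e : Quiver.Costar v,
    ⟨(A (edge e)).conjTranspose * A (edge e), Matrix.isHermitian_conjTranspose_mul_self _⟩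

end

/-- `S` is a smooth (embedded) submanifold of dimension `n` of the Euclidean space `ℝ^N`: around
each of its points there is a smooth chart of `ℝ^N`, with smooth inverse, that maps `S` onto an
`n`-dimensional linear slice. -/
def IsEuclideanSubmanifold {N : ℕ} (S : Set (EuclideanSpace ℝ (Fin N))) (n : ℕ) : Prop :=
  ∀ p ∈ S, ∃ (φ : OpenPartialHomeomorph (EuclideanSpace ℝ (Fin N)) (EuclideanSpace ℝ (Fin N)))
    (W : Submodule ℝ (EuclideanSpace ℝ (Fin N))),
    p ∈ φ.source ∧
    ContDiffOn ℝ ((⊤ : ℕ∞) : WithTop ℕ∞) φ φ.source ∧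
    ContDiffOn ℝ ((⊤ : ℕ∞) : WithTop ℕ∞) φ.symm φ.target ∧
    Module.finrank ℝ W = n ∧
    φ '' (φ.source ∩ S) = φ.target ∩ (W : Set (EuclideanSpace ℝ (Fin N)))

/-- `S` is a smooth submanifold of dimension `n` of the finite-dimensional real vector space `F`
with its usual topology and smooth structure, i.e. those transported from `ℝ^N` by a linear
isomorphism (they do not depend on its choice). -/
def IsSmoothSubmanifold {F : Type*} [AddCommGroup F] [Module ℝ F] [TopologicalSpace F]
    (S : Set F) (n : ℕ) : Prop :=
  ∃ (N : ℕ) (L : F ≃L[ℝ] EuclideanSpace ℝ (Fin N)), IsEuclideanSubmanifold (L '' S) n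

end MatrixModule

/-! `MR d` is a level set of a quadratic map, and the regular value theorem applies. The derivative
of `f` at `A` sends `A'` to `R_v^* R'_v + R'_v^* R_v`; if every `R_v` is an isometry, a Hermitian
`C` is the image of `R'_v = R_v C_v / 2` (`polarization_surjective`). Hence the dimension is that of
`M d` minus that of the Hermitian target, taken over the support of `d` so that the target is
finite-dimensional. Compactness holds because columns of isometries are unit vectors. -/

/-! ### Regular level sets -/

/-- A level set of a smooth map at whose points the derivative is surjective is a submanifold. -/
theorem MatrixModule.isEuclideanSubmanifold_levelSet {N : ℕ} {F : Type*} [NormedAddCommGroup F]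
    [NormedSpace ℝ F] [FiniteDimensional ℝ F] {g : EuclideanSpace ℝ (Fin N) → F}
    (hg : ContDiff ℝ ((⊤ : ℕ∞) : WithTop ℕ∞) g) (c : F)
    (hsurj : ∀ p, g p = c → Function.Surjective (fderiv ℝ g p)) :
    MatrixModule.IsEuclideanSubmanifold (g ⁻¹' {c}) (N - Module.finrank ℝ F) := by
  intro p hp
  have hg' : (fderiv ℝ g p).range = ⊤ := LinearMap.range_eq_top.2 (hsurj p hp)
  have hdim : Module.finrank ℝ F + Module.finrank ℝ (fderiv ℝ g p).ker = N := by
    have h := (fderiv ℝ g p).toLinearMap.finrank_range_add_finrank_ker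
    rw [hg', finrank_top, finrank_euclideanSpace_fin] at h
    exact h
  obtain ⟨P, hP⟩ := Submodule.ClosedComplemented.of_finiteDimensional (fderiv ℝ g p).ker
  let T : (F × (fderiv ℝ g p).ker) ≃L[ℝ] EuclideanSpace ℝ (Fin N) :=
    ContinuousLinearEquiv.ofFinrankEq (by simp [hdim])
  -- `Φ` straightens the level set: its derivative at `p` is invertible, since `P` restores the
  -- kernel that `fderiv ℝ g p` loses.
  let Φ : EuclideanSpace ℝ (Fin N) → EuclideanSpace ℝ (Fin N) := fun x => T (g x - c, P x)
  have hΦ : ContDiff ℝ ((⊤ : ℕ∞) : WithTop ℕ∞) Φ :=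
    T.contDiff.comp ((hg.sub contDiff_const).prodMk P.contDiff)
  have hPr : P.range = ⊤ := LinearMap.range_eq_top.2 fun y => ⟨y, hP y⟩
  let Q : EuclideanSpace ℝ (Fin N) ≃L[ℝ] EuclideanSpace ℝ (Fin N) :=
    ((fderiv ℝ g p).equivProdOfSurjectiveOfIsCompl P hg' hPr
      (LinearMap.isCompl_of_proj hP)).trans T
  have hQ : HasFDerivAt Φ (Q : EuclideanSpace ℝ (Fin N) →L[ℝ] EuclideanSpace ℝ (Fin N)) p := by
    have h1 : HasFDerivAt (fun x => g x - c) (fderiv ℝ g p) p :=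
      ((hg.differentiable (by simp)).differentiableAt.hasFDerivAt).sub_const c
    exact T.hasFDerivAt.comp p (h1.prodMk P.hasFDerivAt)
  -- Shrinking to the points with invertible derivative makes the inverse smooth on the whole
  -- target, not only at `Φ p`.
  let U : Set (EuclideanSpace ℝ (Fin N)) :=
    fderiv ℝ Φ ⁻¹' Set.range ContinuousLinearEquiv.toContinuousLinearMap
  have hU : IsOpen U :=
    ContinuousLinearEquiv.isOpen.preimage (hΦ.continuous_fderiv (by simp))
  let φ := (hΦ.contDiffAt.toOpenPartialHomeomorph Φ hQ (by simp)).restrOpen U hU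
  have hφ : ⇑φ = Φ := rfl
  have hφU : φ.source ⊆ U := fun x hx => hx.2
  let π : EuclideanSpace ℝ (Fin N) →ₗ[ℝ] F :=
    LinearMap.fst ℝ F (fderiv ℝ g p).ker ∘ₗ T.symm.toLinearMap
  refine ⟨φ, LinearMap.ker π, ?_, ?_, ?_, ?_, ?_⟩
  · exact ⟨hΦ.contDiffAt.mem_toOpenPartialHomeomorph_source hQ (by simp), Q, hQ.fderiv.symm⟩
  · rw [hφ]
    exact hΦ.contDiffOn
  · intro y hy
    obtain ⟨e, he⟩ := hφU (φ.map_target hy)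
    refine (φ.contDiffAt_symm hy (f₀' := e) ?_ (hφ ▸ hΦ.contDiffAt)).contDiffWithinAt
    rw [he, hφ]
    exact (hΦ.differentiable (by simp)).differentiableAt.hasFDerivAt
  · have h := LinearMap.finrank_range_add_finrank_ker π
    have hs : Function.Surjective π := Prod.fst_surjective.comp T.symm.surjective
    rw [LinearMap.range_eq_top.2 hs, finrank_top,
      finrank_euclideanSpace_fin] at h
    omega
  · have key : ∀ x, Φ x ∈ LinearMap.ker π ↔ g x = c := by
      intro x
      simp [Φ, π, LinearMap.mem_ker, sub_eq_zero]
    ext y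
    constructor
    · rintro ⟨x, ⟨hx, hxc⟩, rfl⟩
      exact ⟨φ.map_source hx, (key x).2 hxc⟩
    · rintro ⟨hy, hyW⟩
      refine ⟨φ.symm y, ⟨φ.map_target hy, (key _).1 ?_⟩, φ.right_inv hy⟩
      rw [← hφ, φ.right_inv hy]
      exact hyW

/-- A nonsingular quadratic level set is a submanifold. -/
theorem MatrixModule.isSmoothSubmanifold_quadratic {E F : Type*} [AddCommGroup E] [Module ℝ E]
    [TopologicalSpace E] [IsTopologicalAddGroup E] [ContinuousSMul ℝ E] [T2Space E]
    [FiniteDimensional ℝ E] [AddCommGroup F] [Module ℝ F] [FiniteDimensional ℝ F]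
    (B : E →ₗ[ℝ] E →ₗ[ℝ] F) (hB : ∀ x y, B x y = B y x) (c : F)
    (hsurj : ∀ p, B p p = c → Function.Surjective (B p)) :
    MatrixModule.IsSmoothSubmanifold {x | B x x = c}
      (Module.finrank ℝ E - Module.finrank ℝ F) := by
  -- `E` has a topology but no chosen norm, so the calculus is done in Euclidean coordinates.
  let L : E ≃L[ℝ] EuclideanSpace ℝ (Fin (Module.finrank ℝ E)) :=
    ContinuousLinearEquiv.ofFinrankEq finrank_euclideanSpace_fin.symm
  let l : F ≃ₗ[ℝ] EuclideanSpace ℝ (Fin (Module.finrank ℝ F)) :=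
    LinearEquiv.ofFinrankEq _ _ finrank_euclideanSpace_fin.symm
  obtain ⟨b, hb⟩ : ∃ b : EuclideanSpace ℝ (Fin (Module.finrank ℝ E)) →L[ℝ]
      EuclideanSpace ℝ (Fin (Module.finrank ℝ E)) →L[ℝ] EuclideanSpace ℝ (Fin (Module.finrank ℝ F)),
      ∀ x y, b x y = l (B (L.symm x) (L.symm y)) :=
    ⟨LinearMap.toContinuousBilinearMap
      ((B.compl₁₂ L.symm.toLinearMap L.symm.toLinearMap).compr₂ l.toLinearMap), fun x y => by simp⟩
  refine ⟨_, L, ?_⟩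
  have hderiv : ∀ x, HasFDerivAt (fun x => b x x) ((2 : ℝ) • b x) x := by
    intro x
    have h := b.hasFDerivAt_of_bilinear (hasFDerivAt_id (𝕜 := ℝ) x) (hasFDerivAt_id (𝕜 := ℝ) x)
    refine h.congr_fderiv ?_
    ext1 y
    simp [hb, hB (L.symm y), two_smul]
  have hmain := MatrixModule.isEuclideanSubmanifold_levelSet (g := fun x => b x x)
    (b.isBoundedBilinearMap.contDiff.comp (contDiff_id.prodMk contDiff_id)) (l c) ?_
  · rw [finrank_euclideanSpace_fin] at hmain
    convert hmain using 1
    ext y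
    simp only [hb, Set.mem_image, Set.mem_ofPred_eq, Set.mem_preimage, Set.mem_singleton_iff,
      EmbeddingLike.apply_eq_iff_eq]
    exact ⟨by rintro ⟨x, hx, rfl⟩; simpa using hx, fun h => ⟨L.symm y, h, by simp⟩⟩
  · intro p hp y
    -- The factor `2⁻¹` cancels the `2` in the derivative of `x ↦ b x x`.
    obtain ⟨x, hx⟩ := hsurj (L.symm p) (l.injective ((hb p p).symm.trans hp)) ((2 : ℝ)⁻¹ • l.symm y)
    refine ⟨L x, ?_⟩
    rw [(hderiv p).fderiv]
    simp [hb, hx]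

namespace MatrixModule

/-! ### Dimensions and block columns -/

/-- Multiplication by `I` identifies the self-adjoint with the skew-adjoint matrices. -/
theorem finrank_skewAdjoint_matrix (n : ℕ) :
    Module.finrank ℝ (skewAdjoint (Matrix (Fin n) (Fin n) ℂ)) =
      Module.finrank ℝ (selfAdjoint (Matrix (Fin n) (Fin n) ℂ)) := by
  let e : skewAdjoint (Matrix (Fin n) (Fin n) ℂ) ≃ₗ[ℝ] selfAdjoint (Matrix (Fin n) (Fin n) ℂ) :=
    { toFun := fun A => ⟨Complex.I • (A : Matrix (Fin n) (Fin n) ℂ), by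
        rw [selfAdjoint.mem_iff, star_smul, skewAdjoint.mem_iff.1 A.2]; simp⟩
      invFun := fun A => ⟨(-Complex.I) • (A : Matrix (Fin n) (Fin n) ℂ), by
        rw [skewAdjoint.mem_iff, star_smul, selfAdjoint.mem_iff.1 A.2]; simp⟩
      map_add' := fun A B => Subtype.ext (by simp)
      map_smul' := fun r A => Subtype.ext (smul_comm Complex.I r A.1)
      left_inv := fun A => Subtype.ext (by simp [smul_smul])
      right_inv := fun A => Subtype.ext (by simp [smul_smul]) }
  exact e.finrank_eq

instance finiteDimensional_selfAdjoint_matrix (n : ℕ) :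
    FiniteDimensional ℝ (selfAdjoint (Matrix (Fin n) (Fin n) ℂ)) :=
  Module.Finite.of_injective
    (selfAdjoint.submodule ℝ (Matrix (Fin n) (Fin n) ℂ)).subtype Subtype.val_injective

/-- The self-adjoint and skew-adjoint parts have equal dimension and together fill the `2 n ^ 2`
real dimensions. -/
theorem finrank_selfAdjoint_matrix (n : ℕ) :
    Module.finrank ℝ (selfAdjoint (Matrix (Fin n) (Fin n) ℂ)) = n ^ 2 := by
  have : FiniteDimensional ℝ (skewAdjoint (Matrix (Fin n) (Fin n) ℂ)) :=
    Module.Finite.of_injective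
      (skewAdjoint.submodule ℝ (Matrix (Fin n) (Fin n) ℂ)).subtype Subtype.val_injective
  have h := (StarModule.decomposeProdAdjoint ℝ (Matrix (Fin n) (Fin n) ℂ)).finrank_eq
  rw [Module.finrank_prod, finrank_skewAdjoint_matrix, Module.finrank_matrix] at h
  simp at h
  nlinarith

section

variable {V : Type*} [Quiver V]

theorem R_injective {d : V →₀ ℕ} {A A' : M d} (h : ∀ v, R A v = R A' v) : A = A' := by
  funext ⟨u, v, e⟩
  ext i j
  exact congrFun (congrFun (h v) ⟨⟨u, e⟩, i⟩) j

/-- The module with prescribed block columns. -/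
def ofColumns {d : V →₀ ℕ}
    (X : ∀ v : V, Matrix (Σ e : Quiver.Costar v, Fin (d e.1)) (Fin (d v)) ℂ) : M d :=
  fun e => Matrix.of fun i j => X e.right ⟨⟨e.left, e.hom⟩, i⟩ j

@[simp]
theorem R_ofColumns {d : V →₀ ℕ}
    (X : ∀ v : V, Matrix (Σ e : Quiver.Costar v, Fin (d e.1)) (Fin (d v)) ℂ) (v : V) :
    R (ofColumns X) v = X v := rfl

open Classical in
/-- An element of `M(d)` is the family of its block columns at the vertices in the support. -/
noncomputable def columns (d : V →₀ ℕ) : M d ≃ₗ[ℝ]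
    ∀ v : d.support, Matrix (Σ e : Quiver.Costar (v : V), Fin (d e.1)) (Fin (d v)) ℂ where
  toFun A v := R A v
  invFun X := ofColumns fun v => if h : v ∈ d.support then X ⟨v, h⟩ else 0
  map_add' _ _ := rfl
  map_smul' _ _ := rfl
  left_inv A := R_injective fun v => by
    rw [R_ofColumns]
    split_ifs with h
    · rfl
    · ext i j
      exact (Fin.cast (Finsupp.notMem_support_iff.1 h) j).elim0
  right_inv X := by
    funext v
    exact (R_ofColumns _ _).trans (dif_pos v.2)

variable [∀ v : V, Fintype (Quiver.Costar v)]

theorem card_column_index (d : V →₀ ℕ) (v : V) :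
    Fintype.card (Σ e : Quiver.Costar v, Fin (d e.1)) = D d v := by
  simp [D]

instance finiteDimensional_M (d : V →₀ ℕ) : FiniteDimensional ℝ (M d) :=
  Module.Finite.equiv (columns d).symm

theorem finrank_M (d : V →₀ ℕ) :
    Module.finrank ℝ (M d) = ∑ v ∈ d.support, 2 * (D d v * d v) := by
  rw [(columns d).finrank_eq, Module.finrank_pi_fintype,
    ← Finset.sum_coe_sort d.support fun v => 2 * (D d v * d v)]
  refine Finset.sum_congr rfl fun v _ => ?_
  rw [Module.finrank_matrix, card_column_index, Complex.finrank_real_complex, Fintype.card_fin]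
  ring

/-! ### Nonemptiness and compactness -/

theorem conjTranspose_R_mul_R {d : V →₀ ℕ} (A : M d) (v : V) :
    (R A v).conjTranspose * R A v = f A v := by
  ext i j
  simp [f, R, Matrix.mul_apply, Fintype.sum_sigma, Matrix.sum_apply]

theorem MR_eq_preimage (d : V →₀ ℕ) : MR d = f ⁻¹' {(fun _ => 1 : H d)} := by
  ext A
  simp only [MR, Set.mem_ofPred_eq, Set.mem_preimage, Set.mem_singleton_iff, funext_iff,
    conjTranspose_R_mul_R, Subtype.ext_iff, selfAdjoint.val_one]

theorem nonempty_MR {d : V →₀ ℕ} (hd : ∀ v : V, d v ≤ D d v) : (MR d).Nonempty := by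
  classical
  have hι : ∀ v : V, Nonempty (Fin (d v) ↪ Σ e : Quiver.Costar v, Fin (d e.1)) := fun v =>
    Function.Embedding.nonempty_of_card_le (by rw [card_column_index, Fintype.card_fin]; exact hd v)
  -- The columns of each block are distinct standard basis vectors, hence orthonormal.
  refine ⟨ofColumns fun v => Matrix.of fun i j => if i = (hι v).some j then 1 else 0, fun v => ?_⟩
  ext i j
  simp [Matrix.mul_apply, Matrix.one_apply, eq_comm]

theorem isClosed_MR (d : V →₀ ℕ) : IsClosed (MR d) := by
  have h : MR d = ⋂ v : V, {A | (R A v).conjTranspose * R A v = 1} := by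
    ext; simp [MR]
  rw [h]
  refine isClosed_iInter fun v => isClosed_eq ?_ continuous_const
  have hR : Continuous fun A : M d => R A v := by
    refine continuous_matrix fun i j => ?_
    exact (continuous_apply_apply i.2 j).comp (continuous_apply (edge i.1))
  exact hR.matrix_conjTranspose.matrix_mul hR

/-- The `j`-th diagonal entry of `R_v^* R_v = 1` says that column `j` is a unit vector. -/
theorem norm_apply_le_one {d : V →₀ ℕ} {A : M d} (hA : A ∈ MR d) (e : Quiver.Total V)
    (i : Fin (d e.left)) (j : Fin (d e.right)) : ‖A e i j‖ ≤ 1 := by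
  have h := congrFun (congrFun (hA e.right) j) j
  rw [Matrix.mul_apply, Matrix.one_apply_eq] at h
  have h' : ∑ p, ‖R A e.right p j‖ ^ 2 = 1 := by
    have := congrArg Complex.re h
    simpa [← Complex.normSq_eq_conj_mul_self, Complex.normSq_eq_norm_sq, ← Complex.ofReal_pow]
      using this
  have hle := Finset.single_le_sum (f := fun p => ‖R A e.right p j‖ ^ 2)
    (fun p _ => by positivity) (Finset.mem_univ ⟨⟨e.left, e.hom⟩, i⟩)
  rw [h'] at hle
  exact (sq_le_one_iff₀ (norm_nonneg _)).1 hle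

theorem isCompact_MR (d : V →₀ ℕ) : IsCompact (MR d) := by
  have hK : IsCompact (Set.univ.pi fun e : Quiver.Total V =>
      (Set.univ.pi fun _ : Fin (d e.left) => Set.univ.pi fun _ : Fin (d e.right) =>
        Metric.closedBall (0 : ℂ) 1 : Set (Matrix (Fin (d e.left)) (Fin (d e.right)) ℂ))) :=
    isCompact_univ_pi fun _ => isCompact_univ_pi fun _ => isCompact_univ_pi fun _ =>
      isCompact_closedBall 0 1
  refine hK.of_isClosed_subset (isClosed_MR d) fun A hA e _ i _ j _ => ?_
  simpa using norm_apply_le_one hA e i j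

/-! ### Smoothness and dimension -/

/-- The polarization of `2 f`, restricted to the vertices in the support. -/
noncomputable def polarization (d : V →₀ ℕ) :
    M d →ₗ[ℝ] M d →ₗ[ℝ] ∀ v : d.support, selfAdjoint (Matrix (Fin (d v)) (Fin (d v)) ℂ) :=
  LinearMap.mk₂ ℝ
    (fun A A' v => ⟨(R A v).conjTranspose * R A' v + (R A' v).conjTranspose * R A v, by
      rw [selfAdjoint.mem_iff, Matrix.star_eq_conjTranspose]
      simp [Matrix.conjTranspose_mul, add_comm]⟩)
    (fun A B C => by
      funext v
      have h : R (A + B) v = R A v + R B v := rfl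
      refine Subtype.ext ?_
      simp only [h, Pi.add_apply, AddSubgroup.coe_add, Matrix.conjTranspose_add, Matrix.add_mul,
        Matrix.mul_add]
      abel)
    (fun c A B => by
      funext v
      have h : R (c • A) v = c • R A v := rfl
      refine Subtype.ext ?_
      simp [h, Matrix.conjTranspose_smul])
    (fun A B C => by
      funext v
      have h : R (B + C) v = R B v + R C v := rfl
      refine Subtype.ext ?_
      simp only [h, Pi.add_apply, AddSubgroup.coe_add, Matrix.conjTranspose_add, Matrix.add_mul,
        Matrix.mul_add]
      abel)
    (fun c A B => by
      funext v
      have h : R (c • B) v = c • R B v := rfl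
      refine Subtype.ext ?_
      simp [h, Matrix.conjTranspose_smul])

theorem polarization_apply {d : V →₀ ℕ} (A A' : M d) (v : d.support) :
    (polarization d A A' v : Matrix (Fin (d v)) (Fin (d v)) ℂ) =
      (R A v).conjTranspose * R A' v + (R A' v).conjTranspose * R A v := rfl

theorem mem_MR_iff_polarization {d : V →₀ ℕ} (A : M d) :
    A ∈ MR d ↔ polarization d A A = fun _ => 1 + 1 := by
  simp only [funext_iff, Subtype.ext_iff, polarization_apply, AddSubgroup.coe_add,
    selfAdjoint.val_one]
  simp only [← two_smul ℝ (_ : Matrix _ _ ℂ)]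
  constructor
  · intro h v
    rw [h v]
  · intro h v
    by_cases hv : v ∈ d.support
    · exact smul_right_injective _ (two_ne_zero' ℝ) (h ⟨v, hv⟩)
    -- Off the support the matrices are empty, so the condition is vacuous.
    · ext i j
      exact (Fin.cast (Finsupp.notMem_support_iff.1 hv) j).elim0

theorem polarization_surjective {d : V →₀ ℕ} {A : M d} (hA : A ∈ MR d) :
    Function.Surjective (polarization d A) := by
  classical
  intro C
  let C' : ∀ v : V, Matrix (Fin (d v)) (Fin (d v)) ℂ := fun v =>
    if h : v ∈ d.support then C ⟨v, h⟩ else 0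
  refine ⟨ofColumns fun v => (2 : ℝ)⁻¹ • (R A v * C' v), ?_⟩
  funext v
  refine Subtype.ext ?_
  have hC : C' v = C v := dif_pos v.2
  have hC' : (C v : Matrix (Fin (d v)) (Fin (d v)) ℂ).conjTranspose = C v :=
    selfAdjoint.mem_iff.1 (C v).2
  rw [polarization_apply, R_ofColumns, hC, Matrix.conjTranspose_smul, Matrix.conjTranspose_mul,
    hC', Matrix.mul_smul, Matrix.smul_mul, Matrix.mul_assoc, ← Matrix.mul_assoc, hA v,
    Matrix.one_mul, Matrix.mul_one, star_trivial, ← add_smul]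
  norm_num

theorem isSmoothSubmanifold_MR (d : V →₀ ℕ) :
    IsSmoothSubmanifold (MR d)
      (∑ v ∈ d.support, 2 * (D d v * d v) - ∑ v ∈ d.support, d v ^ 2) := by
  have h := isSmoothSubmanifold_quadratic (polarization d)
    (fun A A' => by
      funext v
      exact Subtype.ext (add_comm _ _))
    (fun _ => 1 + 1) (fun A hA => polarization_surjective ((mem_MR_iff_polarization A).2 hA))
  rw [finrank_M, Module.finrank_pi_fintype] at h
  simp only [finrank_selfAdjoint_matrix] at h
  rw [Finset.sum_coe_sort d.support (fun v => d v ^ 2)] at h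
  convert h using 1
  ext A
  exact mem_MR_iff_polarization A

/-- Edges are grouped by range; only the finitely many with range in the support contribute. -/
theorem finsum_total (d : V →₀ ℕ) :
    ∑ᶠ e : Quiver.Total V, (d e.left : ℤ) * (d e.right : ℤ) =
      ∑ v ∈ d.support, (D d v : ℤ) * (d v : ℤ) := by
  let ε : (Σ v : V, Quiver.Costar v) ≃ Quiver.Total V :=
    { toFun := fun p => edge p.2
      invFun := fun e => ⟨e.right, e.left, e.hom⟩
      left_inv := fun _ => rfl
      right_inv := fun _ => rfl }
  rw [← finsum_comp_equiv ε,
    finsum_eq_sum_of_support_subset (s := d.support.sigma fun _ => Finset.univ), Finset.sum_sigma]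
  · refine Finset.sum_congr rfl fun v _ => ?_
    rw [D, Nat.cast_sum, Finset.sum_mul]
    rfl
  · rintro ⟨v, e⟩ h
    simp only [Finset.coe_sigma, Set.mem_sigma_iff, Finset.mem_coe, Finsupp.mem_support_iff]
    refine ⟨fun h0 => h ?_, by simp⟩
    simp [ε, h0]

end

end MatrixModule

theorem mainTheorem9 {V : Type*} [Quiver V] [∀ v : V, Fintype (Quiver.Costar v)]
    (d : V →₀ ℕ) (hd : ∀ v : V, d v ≤ MatrixModule.D d v) :
    MatrixModule.MR d = MatrixModule.f ⁻¹' {(fun _ => 1 : MatrixModule.H d)} ∧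
    (MatrixModule.MR d).Nonempty ∧
    IsCompact (MatrixModule.MR d) ∧
    ∃ n : ℕ, MatrixModule.IsSmoothSubmanifold (MatrixModule.MR d) n ∧
      (n : ℤ) = ∑ v ∈ d.support, (d v : ℤ) * (2 * (MatrixModule.D d v : ℤ) - (d v : ℤ)) ∧
      (n : ℤ) = 2 * (∑ᶠ e : Quiver.Total V, (d e.left : ℤ) * (d e.right : ℤ))
        - ∑ v ∈ d.support, (d v : ℤ) ^ 2 ∧
      ∑ v ∈ d.support, d v ^ 2 ≤ n := by
  -- This yields the final inequality and also shows that the natural subtraction in the dimension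
  -- does not truncate.
  have hle : 2 * ∑ v ∈ d.support, d v ^ 2 ≤ ∑ v ∈ d.support, 2 * (MatrixModule.D d v * d v) := by
    rw [Finset.mul_sum]
    refine Finset.sum_le_sum fun v _ => ?_
    rw [sq]
    exact Nat.mul_le_mul_left 2 (Nat.mul_le_mul_right _ (hd v))
  refine ⟨MatrixModule.MR_eq_preimage d, MatrixModule.nonempty_MR hd, MatrixModule.isCompact_MR d,
    _, MatrixModule.isSmoothSubmanifold_MR d, ?_, ?_, by omega⟩
  · rw [Nat.cast_sub (by omega)]
    push_cast
    rw [← Finset.sum_sub_distrib]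
    exact Finset.sum_congr rfl fun v _ => by ring
  · rw [Nat.cast_sub (by omega), MatrixModule.finsum_total, Finset.mul_sum]
    push_cast
    rfl
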